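/- Let $\mathbf M$ be a countable first-order structure and equip $\mathrm{Aut}(\mathbf M)$ with the permutation group topology, in which the cosets $fV_A$ form a basis, where $f\in\mathrm{Aut}(\mathbf M)$ and $V_A$ is the pointwise stabiliser of a finite set $A\subseteq\mathbf M$. For a finite tuple $\overline a$ of elements of $\mathbf M$ let $V_{\overline a}=\{g: g\cdot\overline a=\overline a\}$ and $\mathcal O(\overline a)=\mathrm{Aut}(\mathbf M)\cdot\overline a$; the sets $\mathcal O(\overline a)$ are called orbital types. For a finite family $\mathcal R$ of orbital types let $\mathbb X_{\overline a,\mathcal R}$ be the graph with vertex set $\mathcal O(\overline a)$ in which $\overline b,\overline c$ are adjacent if and only if $\overline b\neq\overline c$ and ($\mathcal O(\overline b,\overline c)\in\mathcal R$ or $\mathcal O(\overline c,\overline b)\in\mathcal R$), and let $\rho_{\overline a,\mathcal R}$ be its shortest path distance. For compatible left-invariant metrics $\partial,d$ on a metrisable topological group $G$ write $\partial\lesssim d$ if $\partial\leq K\cdot d+K$ for some constant $K$; such a $d$ is maximal if it is maximal for this preorder among all compatible left-invariant metrics. A set $A\subseteq G$ has property (OB) relative to $G$ if it has finite diameter in every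 compatible left-invariant metric on $G$. A map $F:(X,d_X)\to(Y,d_Y)$ is a quasi-isometry if there are constants $K\geq 1$, $C\geq 0$ with $\frac1K d_X(x,y)-C\leq d_Y(Fx,Fy)\leq K d_X(x,y)+C$ for all $x,y\in X$ and such that every point of $Y$ is within distance $C$ of $F[X]$. **Theorem.** $\mathrm{Aut}(\mathbf M)$ admits a maximal compatible left-invariant metric if and only if there is a finite tuple $\overline a$ in $\mathbf M$ such that 1. for every finite tuple $\overline b$ there are a finite family $\mathcal S$ of orbital types and an $n\geq1$ such that, whenever $(\overline a,\overline c)\in\mathcal O(\overline a,\overline b)$, there are $\overline d_0,\dots,\overline d_n\in\mathcal O(\overline a,\overline b)$ with $\overline d_0=(\overline a,\overline b)$, $\overline d_n=(\overline a,\overline c)$ and $\mathcal O(\overline d_i,\overline d_{i+1})\in\mathcal S$ for all $i<n$; and 2. there is a finite family $\mathcal R$ of orbital types such that for every $\overline b\in\mathcal O(\overline a)$ there are $m\geq 0$ and $\overline d_0,\dots,\overline d_m\in\mathcal O(\overline a)$ with $\overline d_0=\overline a$, $\overline d_m=\overline b$ and $\mathcal O(\overline d_i,\overline d_{i+1})\in\mathcal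 R$ for all $i<m$. For every finite tuple $\overline a$, condition (1) holds if and only if $V_{\overline a}$ has property (OB) relative to $\mathrm{Aut}(\mathbf M)$, and condition (2) holds if and only if $\mathbb X_{\overline a,\mathcal R}$ is connected for some finite family $\mathcal R$ of orbital types. Moreover, if $\overline a$ satisfies (1) and $\mathcal R$ is as in (2) for $\overline a$, then $\mathbb X_{\overline a,\mathcal R}$ is connected and, for every maximal compatible left-invariant metric $d$ on $\mathrm{Aut}(\mathbf M)$, the map $g\mapsto g\cdot\overline a$ is a quasi-isometry from $(\mathrm{Aut}(\mathbf M),d)$ to $(\mathbb X_{\overline a,\mathcal R},\rho_{\overline a,\mathcal R})$. -/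

import Mathlib

open FirstOrder

namespace OrbitalGeometry

/-! ### Automorphism groups with the permutation group topology -/

/-- The automorphism group of the first-order structure `M`. -/
abbrev Aut (L : Language) (M : Type*) [L.Structure M] : Type _ := M ≃[L] M

/-- The group operation on `Aut L M` is composition. -/
instance autGroup (L : Language) (M : Type*) [L.Structure M] : Group (Aut L M) where
  mul g h := g.comp h
  one := Language.Equiv.refl L M
  inv g := g.symm
  mul_assoc _ _ _ := rfl
  one_mul _ := rfl
  mul_one _ := rfl
  inv_mul_cancel g := Language.Equiv.ext fun x => g.symm_apply_apply x

/-- The permutation group topology: the cosets `f V_A`, where `f` is an automorphism and `V_A` is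
the pointwise stabiliser of a finite set `A`, form a basis. -/
instance autTopology (L : Language) (M : Type*) [L.Structure M] :
    TopologicalSpace (Aut L M) where
  IsOpen U := ∀ f ∈ U, ∃ A : Finset M, ∀ v : Aut L M, (∀ x ∈ A, v x = x) → f * v ∈ U
  isOpen_univ _ _ := ⟨∅, fun _ _ => trivial⟩
  isOpen_inter U W hU hW f hf := by
    classical
    obtain ⟨A, hA⟩ := hU f hf.1
    obtain ⟨B, hB⟩ := hW f hf.2
    exact ⟨A ∪ B, fun v hv =>
      ⟨hA v fun x hx => hv x (Finset.mem_union_left B hx),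
        hB v fun x hx => hv x (Finset.mem_union_right A hx)⟩⟩
  isOpen_sUnion 𝒰 h𝒰 f hf := by
    obtain ⟨U, hU, hfU⟩ := hf
    obtain ⟨A, hA⟩ := h𝒰 U hU f hfU
    exact ⟨A, fun v hv => ⟨U, hU, hA v hv⟩⟩

/-! ### Compatible left-invariant metrics -/

/-- The metric `d` is left-invariant and induces the given topology of the group `G`. -/
def IsCompatibleLeftInvariant {G : Type*} [Group G] [t : TopologicalSpace G]
    (d : MetricSpace G) : Prop :=
  d.toUniformSpace.toTopologicalSpace = t ∧
    ∀ g x y : G, d.dist (g * x) (g * y) = d.dist x y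

/-- The relation `∂ ≲ d`, that is, `∂ ≤ K * d + K` for some constant `K`. -/
def CoarselyLE {G : Type*} (del d : MetricSpace G) : Prop :=
  ∃ K : ℝ, ∀ x y : G, del.dist x y ≤ K * d.dist x y + K

/-- `d` is a maximal element, for the preorder `CoarselyLE`, among the compatible left-invariant
metrics on the group `G`. -/
def IsMaximalMetric {G : Type*} [Group G] [TopologicalSpace G] (d : MetricSpace G) : Prop :=
  IsCompatibleLeftInvariant d ∧
    ∀ del : MetricSpace G, IsCompatibleLeftInvariant del → CoarselyLE d del → CoarselyLE del d

/-- `A` has property (OB) relative to `G`: it has finite diameter with respect to every compatible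
left-invariant metric on `G`. -/
def HasRelativeOB {G : Type*} [Group G] [TopologicalSpace G] (A : Set G) : Prop :=
  ∀ d : MetricSpace G, IsCompatibleLeftInvariant d →
    ∃ C : ℝ, ∀ x ∈ A, ∀ y ∈ A, d.dist x y ≤ C

/-- `F` is a quasi-isometry from `(X, dX)` to `(Y, dY)`. -/
def IsQuasiIsometry {X Y : Type*} (dX : X → X → ℝ) (dY : Y → Y → ℝ) (F : X → Y) : Prop :=
  ∃ K C : ℝ, 1 ≤ K ∧ 0 ≤ C ∧
    (∀ x y : X, 1 / K * dX x y - C ≤ dY (F x) (F y) ∧ dY (F x) (F y) ≤ K * dX x y + C) ∧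
    ∀ y : Y, ∃ x : X, dY y (F x) ≤ C

/-! ### Orbital types

Finite tuples of elements of `M` are lists, concatenation of tuples is `++`, and `g` acts on a
tuple `a` by `a.map g`. -/

section

variable (L : Language) {M : Type*} [L.Structure M]

/-- The pointwise stabiliser `V_a` of the tuple `a`. -/
def tupleStabilizer (a : List M) : Set (Aut L M) :=
  {g | a.map g = a}

/-- The orbital type `𝒪(a)`, that is, the orbit of the tuple `a` under `Aut L M`. -/
def orbitalType (a : List M) : Set (List M) :=
  {b | ∃ g : Aut L M, a.map g = b}

/-- `S` is a finite family of orbital types in `M`. -/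
def IsFiniteOrbitalFamily (S : Set (Set (List M))) : Prop :=
  S.Finite ∧ ∀ O ∈ S, ∃ a : List M, O = orbitalType L a

/-- `d 0, …, d n` is a path in `V` with `𝒪(d i, d (i + 1)) ∈ S` for all `i < n`, which starts
at `x` and ends at `y`. Only the values `d i` with `i ≤ n` matter. -/
def IsOrbitalPath (V : Set (List M)) (S : Set (Set (List M))) (x y : List M)
    (n : ℕ) (d : ℕ → List M) : Prop :=
  (∀ i ≤ n, d i ∈ V) ∧ d 0 = x ∧ d n = y ∧
    ∀ i < n, orbitalType L (d i ++ d (i + 1)) ∈ S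

/-- For every tuple `b` there are a finite family `S` of orbital types and `n ≥ 1` such that,
whenever `(a, c) ∈ 𝒪(a, b)`, some `S`-path of length `n` in `𝒪(a, b)` leads from `(a, b)` to
`(a, c)`. -/
def StabilizerCondition (a : List M) : Prop :=
  ∀ b : List M, ∃ S : Set (Set (List M)), IsFiniteOrbitalFamily L S ∧ ∃ n : ℕ, 1 ≤ n ∧
    ∀ c : List M, a ++ c ∈ orbitalType L (a ++ b) →
      ∃ d : ℕ → List M, IsOrbitalPath L (orbitalType L (a ++ b)) S (a ++ b) (a ++ c) n d

/-- `R` is a finite family of orbital types such that every `b ∈ 𝒪(a)` is reached from `a` by a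
finite `R`-path in `𝒪(a)`. -/
def IsConnectingFamily (a : List M) (R : Set (Set (List M))) : Prop :=
  IsFiniteOrbitalFamily L R ∧ ∀ b ∈ orbitalType L a,
    ∃ (m : ℕ) (d : ℕ → List M), IsOrbitalPath L (orbitalType L a) R a b m d

/-- The graph `𝕏_{a, R}` on the vertex set `𝒪(a)`. -/
def orbitalGraph (a : List M) (R : Set (Set (List M))) : SimpleGraph (orbitalType L a) where
  Adj b c := b ≠ c ∧
    (orbitalType L (b.1 ++ c.1) ∈ R ∨ orbitalType L (c.1 ++ b.1) ∈ R)
  symm := ⟨fun _ _ h => ⟨h.1.symm, h.2.symm⟩⟩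
  loopless := ⟨fun _ h => h.1 rfl⟩

/-- The shortest path metric `ρ_{a, R}` of `𝕏_{a, R}`, with real values; meaningful when the graph
is connected. -/
noncomputable def orbitalDist (a : List M) (R : Set (Set (List M)))
    (b c : orbitalType L a) : ℝ :=
  ((orbitalGraph L a R).dist b c : ℝ)

/-- The map `g ↦ g · a` from `Aut L M` to `𝒪(a)`. -/
def orbitMap (a : List M) (g : Aut L M) : orbitalType L a :=
  ⟨a.map g, g, rfl⟩

end

end OrbitalGeometry

open OrbitalGeometry

/-!
The proof replaces metrics by seminorms. A compatible left-invariant metric `d` on `G = Aut(M)` is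
given by the continuous seminorm `g ↦ d(1, g)`, and conversely every continuous seminorm lies below
some compatible left-invariant metric (`exists_metric_ge`): one adds the seminorm whose value at `g`
is the largest weight `2 ^ (-e x)` of a point `x` moved by `g`, where `e : M → ℕ` is injective.
Applied to the sum of a given seminorm and that of a maximal metric, this shows that a maximal
metric dominates *every* continuous seminorm (`IsMaximalMetric.exists_seminorm_le`), and that
relative property (OB) bounds every continuous seminorm.

*Paths bound seminorms.* If `p` is bounded on the stabiliser `V_a`, it is bounded on each double
coset of `V_a`, that is, on the `f⁻¹ g` for which `(f a, g a)` has a fixed orbital type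
(`exists_step_bound`). Hence `p (f⁻¹ g)` is affinely bounded by the length of a path from `f a` to
`g a` whose steps have types in a finite family (`seminorm_le_of_path`). This gives (OB) from
condition (1), and it shows that under (1) each compatible left-invariant metric is coarsely
dominated by the path metric `ρ`. As `g ↦ ρ(a, g a)` is itself a continuous seminorm, a metric above
it is maximal, and any maximal metric is coarsely equivalent to it.

*Words give paths.* The prefixes of a word `h₁ ⋯ hₖ` move `a` along a path whose steps have the
types `𝒪(a, hᵢ a)` (`exists_path_of_word`). As `M` is countable, there are countably many orbital
types, and they can be indexed by `ℕ`. Giving `h` the weight `0` if it fixes `a`, and otherwise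
`φ k + 1` with `k` the index of its step types, yields a continuous word seminorm. For `φ = id` a
bound on this seminorm bounds both the length of the path and the types used, whence (1) from (OB).
For a quickly growing `φ` domination by a maximal metric is impossible unless some finite family of
types connects `𝒪(a)`, whence (2) from the existence of a maximal metric.
-/

namespace OrbitalGeometry

/-! ### Words and word seminorms -/

section Words

variable {G : Type*} [Group G]

/-- The least total weight of a word in the elements of `G` which represents `g`, where each letter
`h` has weight `w h`. -/
noncomputable def wordLength (w : G → ℕ) (g : G) : ℕ :=
  sInf {n | ∃ l : List G, l.prod = g ∧ (l.map w).sum = n}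

lemma wordLength_le (w : G → ℕ) (l : List G) : wordLength w l.prod ≤ (l.map w).sum :=
  Nat.sInf_le ⟨l, rfl, rfl⟩

lemma exists_word (w : G → ℕ) (g : G) :
    ∃ l : List G, l.prod = g ∧ (l.map w).sum = wordLength w g :=
  Nat.sInf_mem (s := {n | ∃ l : List G, l.prod = g ∧ (l.map w).sum = n}) ⟨_, [g], by simp, rfl⟩

lemma wordLength_le_weight (w : G → ℕ) (g : G) : wordLength w g ≤ w g := by
  simpa using wordLength_le w [g]

lemma wordLength_inv_le {w : G → ℕ} (hw : ∀ g, w g⁻¹ = w g) (g : G) :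
    wordLength w g⁻¹ ≤ wordLength w g := by
  obtain ⟨l, rfl, hl⟩ := exists_word w g
  have h := wordLength_le w (l.map Inv.inv).reverse
  rw [← List.prod_inv_reverse, List.map_reverse, List.sum_reverse, List.map_map] at h
  rw [← hl]
  simpa [Function.comp_def, hw] using h

/-- The word length for an inversion-invariant weight, as a seminorm on the group. -/
noncomputable def wordSeminorm (w : G → ℕ) (hw : ∀ g, w g⁻¹ = w g) : GroupSeminorm G where
  toFun g := wordLength w g
  map_one' := by
    have h := wordLength_le w ([] : List G)
    simpa using h
  mul_le' x y := by
    obtain ⟨l, rfl, hl⟩ := exists_word w x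
    obtain ⟨k, rfl, hk⟩ := exists_word w y
    have h := wordLength_le w (l ++ k)
    rw [List.prod_append, List.map_append, List.sum_append, hl, hk] at h
    exact_mod_cast h
  inv' x := by
    have h := wordLength_inv_le hw x
    have h' := wordLength_inv_le hw x⁻¹
    rw [inv_inv] at h'
    exact_mod_cast le_antisymm h h'

lemma wordSeminorm_apply (w : G → ℕ) (hw : ∀ g, w g⁻¹ = w g) (g : G) :
    wordSeminorm w hw g = wordLength w g := rfl

end Words

/-! ### Automorphisms acting on tuples -/

section Action

variable {L : Language} {M : Type*} [L.Structure M]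

@[simp] lemma autMul_apply (g h : Aut L M) (x : M) : (g * h) x = g (h x) := rfl

lemma autInv_apply_eq_iff (g : Aut L M) (x y : M) : g⁻¹ x = y ↔ x = g y := by
  constructor
  · rintro rfl
    exact (Language.Equiv.apply_symm_apply g x).symm
  · rintro rfl
    exact Language.Equiv.symm_apply_apply g y

lemma map_autMul (g h : Aut L M) (a : List M) : a.map (g * h) = (a.map h).map g := by
  rw [List.map_map]; rfl

@[simp] lemma map_autOne (a : List M) : a.map (1 : Aut L M) = a :=
  List.map_id a

lemma map_autInv_eq_iff (g : Aut L M) (a b : List M) : a.map ⇑g⁻¹ = b ↔ a = b.map g := by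
  constructor
  · rintro rfl
    rw [← map_autMul, mul_inv_cancel, map_autOne]
  · rintro rfl
    rw [← map_autMul, inv_mul_cancel, map_autOne]

lemma mem_tupleStabilizer_iff {a : List M} {g : Aut L M} :
    g ∈ tupleStabilizer L a ↔ ∀ x ∈ a, g x = x := by
  change a.map g = a ↔ _
  conv_lhs => rhs; rw [← List.map_id a]
  exact List.map_inj_left

lemma mem_tupleStabilizer_append {a b : List M} {g : Aut L M} :
    g ∈ tupleStabilizer L (a ++ b) ↔ g ∈ tupleStabilizer L a ∧ g ∈ tupleStabilizer L b := by
  simp only [mem_tupleStabilizer_iff, List.mem_append, or_imp, forall_and]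

lemma inv_mul_mem_tupleStabilizer {a : List M} {f g : Aut L M} (h : a.map f = a.map g) :
    f⁻¹ * g ∈ tupleStabilizer L a := by
  change a.map _ = a
  rw [map_autMul, map_autInv_eq_iff, h]

lemma map_mem_orbitalType (a : List M) (g : Aut L M) : a.map g ∈ orbitalType L a := ⟨g, rfl⟩

lemma self_mem_orbitalType (a : List M) : a ∈ orbitalType L a := ⟨1, map_autOne a⟩

lemma orbitalType_map (a : List M) (g : Aut L M) : orbitalType L (a.map g) = orbitalType L a := by
  ext b
  constructor
  · rintro ⟨f, rfl⟩
    exact ⟨f * g, map_autMul f g a⟩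
  · rintro ⟨f, rfl⟩
    exact ⟨f * g⁻¹, by rw [← map_autMul, inv_mul_cancel_right]⟩

lemma orbitalType_map_append (a b : List M) (g : Aut L M) :
    orbitalType L (a.map g ++ b.map g) = orbitalType L (a ++ b) := by
  rw [← List.map_append, orbitalType_map]

lemma exists_map_eq_of_orbitalType_eq {a b : List M} (h : orbitalType L a = orbitalType L b) :
    ∃ g : Aut L M, a.map g = b := by
  have hb : b ∈ orbitalType L a := h ▸ self_mem_orbitalType b
  exact hb

/-- Passing from `(b, c)` to `(c, b)` is a rotation of lists, which commutes with automorphisms. -/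
lemma orbitalType_swap (b c : List M) :
    orbitalType L (c ++ b) = (fun l => l.rotate b.length) '' orbitalType L (b ++ c) := by
  ext l
  constructor
  · rintro ⟨g, rfl⟩
    exact ⟨(b ++ c).map g, ⟨g, rfl⟩, by
      simp only [← List.map_rotate, List.rotate_append_length_eq]⟩
  · rintro ⟨_, ⟨g, rfl⟩, rfl⟩
    exact ⟨g, by simp only [← List.map_rotate, List.rotate_append_length_eq]⟩

lemma length_of_mem_orbitalType {a b : List M} (h : b ∈ orbitalType L a) :
    b.length = a.length := by
  obtain ⟨g, rfl⟩ := h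
  exact List.length_map _

end Action

/-! ### Continuous seminorms and compatible left-invariant metrics -/

section Metrics

variable {L : Language} {M : Type*} [L.Structure M]

/-- Continuity at the identity, hence everywhere, of a seminorm on `Aut L M`, expressed through
stabilisers of tuples. -/
def IsContinuousSeminorm (p : GroupSeminorm (Aut L M)) : Prop :=
  ∀ ε > 0, ∃ b : List M, ∀ v ∈ tupleStabilizer L b, p v < ε

lemma IsContinuousSeminorm.of_eq_zero {p : GroupSeminorm (Aut L M)} (b : List M)
    (h : ∀ v ∈ tupleStabilizer L b, p v = 0) : IsContinuousSeminorm p :=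
  fun ε hε => ⟨b, fun v hv => by rw [h v hv]; exact hε⟩

lemma IsContinuousSeminorm.add {p q : GroupSeminorm (Aut L M)} (hp : IsContinuousSeminorm p)
    (hq : IsContinuousSeminorm q) : IsContinuousSeminorm (p + q) := by
  intro ε hε
  obtain ⟨b, hb⟩ := hp (ε / 2) (half_pos hε)
  obtain ⟨c, hc⟩ := hq (ε / 2) (half_pos hε)
  refine ⟨b ++ c, fun v hv => ?_⟩
  rw [mem_tupleStabilizer_append] at hv
  rw [add_apply]
  linarith [hb v hv.1, hc v hv.2]

/-- The seminorm `g ↦ d(1, g)` of a left-invariant metric `d`. -/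
def metricSeminorm (d : MetricSpace (Aut L M)) (hd : IsCompatibleLeftInvariant d) :
    GroupSeminorm (Aut L M) where
  toFun g := d.dist 1 g
  map_one' := d.dist_self 1
  mul_le' x y := by
    have h := d.dist_triangle 1 x (x * y)
    have h' := hd.2 x 1 y
    rw [mul_one] at h'
    rwa [h'] at h
  inv' x := by
    have h := hd.2 x 1 x⁻¹
    rw [mul_one, mul_inv_cancel] at h
    rw [← h, d.dist_comm]

lemma dist_eq_metricSeminorm {d : MetricSpace (Aut L M)} (hd : IsCompatibleLeftInvariant d)
    (g h : Aut L M) : d.dist g h = metricSeminorm d hd (g⁻¹ * h) := by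
  have := hd.2 g⁻¹ g h
  rw [inv_mul_cancel] at this
  exact this.symm

lemma isContinuousSeminorm_metricSeminorm {d : MetricSpace (Aut L M)}
    (hd : IsCompatibleLeftInvariant d) : IsContinuousSeminorm (metricSeminorm d hd) := by
  intro ε hε
  have ho : @IsOpen _ d.toUniformSpace.toTopologicalSpace {g | d.dist g 1 < ε} :=
    @Metric.isOpen_ball _ d.toPseudoMetricSpace 1 ε
  rw [hd.1] at ho
  obtain ⟨A, hA⟩ := ho 1 (by
    change d.dist 1 1 < ε
    rw [d.dist_self]; exact hε)
  refine ⟨A.toList, fun v hv => ?_⟩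
  have h := hA v fun x hx => mem_tupleStabilizer_iff.1 hv x (Finset.mem_toList.2 hx)
  change d.dist (1 * v) 1 < ε at h
  rw [one_mul, d.dist_comm] at h
  exact h

lemma bddAbove_support (e : M → ℕ) (s : Set M) :
    BddAbove (Set.range fun x : s => (1 / 2 : ℝ) ^ e x) :=
  ⟨1, by rintro _ ⟨x, rfl⟩; exact pow_le_one₀ (by norm_num) (by norm_num)⟩

lemma iSup_support_nonneg (e : M → ℕ) (s : Set M) : 0 ≤ ⨆ x : s, (1 / 2 : ℝ) ^ e x :=
  Real.iSup_nonneg fun _ => by positivity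

/-- The supremum of the weights `2 ^ (-e x)` of the points `x` which are moved by `g`. -/
noncomputable def supportSeminorm (e : M → ℕ) : GroupSeminorm (Aut L M) where
  toFun g := ⨆ x : {x : M | g x ≠ x}, (1 / 2 : ℝ) ^ e x
  map_one' := by
    have : IsEmpty {x : M | (1 : Aut L M) x ≠ x} := ⟨fun x => x.2 rfl⟩
    exact Real.iSup_of_isEmpty _
  mul_le' g h := by
    have hg0 := iSup_support_nonneg e {x : M | g x ≠ x}
    have hh0 := iSup_support_nonneg e {x : M | h x ≠ x}
    refine Real.iSup_le (fun ⟨x, hx⟩ => ?_) (add_nonneg hg0 hh0)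
    by_cases hh : h x = x
    · have hg : g x ≠ x := fun hg => hx (by rw [autMul_apply, hh, hg])
      have := le_ciSup (bddAbove_support e {x : M | g x ≠ x}) ⟨x, hg⟩
      dsimp only at this ⊢
      linarith
    · have := le_ciSup (bddAbove_support e {x : M | h x ≠ x}) ⟨x, hh⟩
      dsimp only at this ⊢
      linarith
  inv' g := by
    have : {x : M | g⁻¹ x ≠ x} = {x : M | g x ≠ x} := by
      ext x
      exact not_congr ((autInv_apply_eq_iff g x x).trans eq_comm)
    rw [this]

lemma le_supportSeminorm (e : M → ℕ) {g : Aut L M} {x : M} (hx : g x ≠ x) :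
    (1 / 2 : ℝ) ^ e x ≤ supportSeminorm e g :=
  le_ciSup (bddAbove_support e {x : M | g x ≠ x}) ⟨x, hx⟩

lemma isContinuousSeminorm_supportSeminorm {e : M → ℕ} (he : Function.Injective e) :
    IsContinuousSeminorm (supportSeminorm e : GroupSeminorm (Aut L M)) := by
  intro ε hε
  obtain ⟨n, hn⟩ := exists_pow_lt_of_lt_one hε (by norm_num : (1 / 2 : ℝ) < 1)
  have hfin : (e ⁻¹' Set.Iio n).Finite := (Set.finite_Iio n).preimage he.injOn
  refine ⟨hfin.toFinset.toList, fun v hv => lt_of_le_of_lt ?_ hn⟩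
  refine Real.iSup_le (fun ⟨x, hx⟩ => ?_) (by positivity)
  refine pow_le_pow_of_le_one (by norm_num) (by norm_num) (not_lt.1 fun hlt => hx ?_)
  exact mem_tupleStabilizer_iff.1 hv x (by simpa using hlt)

/-- The left-invariant metric `d(g, h) = p(g⁻¹ h)` of a seminorm `p` which vanishes only at the
identity. -/
noncomputable abbrev metricOfSeminorm (p : GroupSeminorm (Aut L M)) (hp : ∀ g, p g = 0 → g = 1) :
    MetricSpace (Aut L M) where
  dist g h := p (g⁻¹ * h)
  dist_self g := by rw [inv_mul_cancel, map_one_eq_zero]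
  dist_comm g h := by rw [← map_inv_eq_map p, mul_inv_rev, inv_inv]
  dist_triangle f g h := by
    have := map_mul_le_add p (f⁻¹ * g) (g⁻¹ * h)
    rwa [mul_assoc, mul_inv_cancel_left] at this
  eq_of_dist_eq_zero h := (inv_mul_eq_one.1 (hp _ h))

lemma isCompatibleLeftInvariant_metricOfSeminorm {p : GroupSeminorm (Aut L M)}
    (hp : ∀ g, p g = 0 → g = 1) (hc : IsContinuousSeminorm p)
    (hpos : ∀ x : M, ∃ ε > 0, ∀ g : Aut L M, p g < ε → g x = x) :
    IsCompatibleLeftInvariant (metricOfSeminorm p hp) := by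
  have hdist : ∀ g h, (metricOfSeminorm p hp).dist g h = p (g⁻¹ * h) := fun _ _ => rfl
  refine ⟨?_, fun g x y => by rw [hdist, hdist, mul_inv_rev, mul_assoc, inv_mul_cancel_left]⟩
  ext U
  rw [@Metric.isOpen_iff _ (metricOfSeminorm p hp).toPseudoMetricSpace]
  constructor
  · intro h f hf
    obtain ⟨ε, hε, hU⟩ := h f hf
    obtain ⟨b, hb⟩ := hc ε hε
    classical
    refine ⟨b.toFinset, fun v hv => hU ?_⟩
    rw [@Metric.mem_ball']
    change p (f⁻¹ * (f * v)) < ε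
    rw [inv_mul_cancel_left]
    exact hb v (mem_tupleStabilizer_iff.2 fun x hx => hv x (List.mem_toFinset.2 hx))
  · intro h f hf
    obtain ⟨A, hA⟩ := h f hf
    have key : ∃ ε > 0, ∀ g : Aut L M, p g < ε → ∀ x ∈ A, g x = x := by
      classical
      clear hA
      induction A using Finset.induction_on with
      | empty => exact ⟨1, one_pos, fun _ _ x hx => absurd hx (Finset.notMem_empty x)⟩
      | insert x A _ ih =>
        obtain ⟨ε, hε, h1⟩ := ih
        obtain ⟨δ, hδ, h2⟩ := hpos x
        refine ⟨min ε δ, lt_min hε hδ, fun g hg y hy => ?_⟩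
        rcases Finset.mem_insert.1 hy with rfl | hy
        · exact h2 g (hg.trans_le (min_le_right _ _))
        · exact h1 g (hg.trans_le (min_le_left _ _)) y hy
    obtain ⟨ε, hε, hg⟩ := key
    refine ⟨ε, hε, fun g hgU => ?_⟩
    rw [@Metric.mem_ball'] at hgU
    have := hA (f⁻¹ * g) (hg _ hgU)
    rwa [mul_inv_cancel_left] at this

/-- Every continuous seminorm is dominated by a compatible left-invariant metric: adding the
support seminorm makes it positive and makes small balls fix any given point. -/
lemma exists_metric_ge [Countable M] {p : GroupSeminorm (Aut L M)} (hp : IsContinuousSeminorm p) :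
    ∃ d : MetricSpace (Aut L M), IsCompatibleLeftInvariant d ∧
      ∀ g h, p (g⁻¹ * h) ≤ d.dist g h := by
  obtain ⟨e, he⟩ := exists_injective_nat M
  let q : GroupSeminorm (Aut L M) := p + supportSeminorm e
  have hq : ∀ g, q g = p g + supportSeminorm e g := fun g => add_apply ..
  have hfix : ∀ (g : Aut L M) (x : M), q g < (1 / 2 : ℝ) ^ e x → g x = x := by
    intro g x hg
    by_contra hx
    have := le_supportSeminorm e hx
    have := apply_nonneg p g
    rw [hq] at hg
    linarith
  have hq0 : ∀ g, q g = 0 → g = 1 := fun g hg =>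
    Language.Equiv.ext fun x => hfix g x (by rw [hg]; positivity)
  refine ⟨metricOfSeminorm q hq0, isCompatibleLeftInvariant_metricOfSeminorm hq0
    (hp.add (isContinuousSeminorm_supportSeminorm he))
    fun x => ⟨_, by positivity, fun g hg => hfix g x hg⟩, fun g h => ?_⟩
  change _ ≤ q (g⁻¹ * h)
  rw [hq]
  exact le_add_of_nonneg_right (apply_nonneg _ _)

/-- A maximal metric dominates every continuous seminorm: compare it with a metric above the sum of
its own seminorm and the given one. -/
lemma IsMaximalMetric.exists_seminorm_le [Countable M] {d : MetricSpace (Aut L M)}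
    (hd : IsMaximalMetric d) {p : GroupSeminorm (Aut L M)} (hp : IsContinuousSeminorm p) :
    ∃ K : ℝ, ∀ g h, p (g⁻¹ * h) ≤ K * d.dist g h + K := by
  obtain ⟨e, he, hle⟩ := exists_metric_ge ((isContinuousSeminorm_metricSeminorm hd.1).add hp)
  have hle' : ∀ g h, d.dist g h + p (g⁻¹ * h) ≤ e.dist g h := fun g h => by
    have := hle g h
    rwa [add_apply, ← dist_eq_metricSeminorm] at this
  have hp0 : ∀ g, 0 ≤ p g := apply_nonneg p
  have hd0 : ∀ g h, 0 ≤ d.dist g h := @dist_nonneg _ d.toPseudoMetricSpace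
  obtain ⟨K, hK⟩ := hd.2 e he ⟨1, fun g h => by linarith [hle' g h, hp0 (g⁻¹ * h)]⟩
  exact ⟨K, fun g h => by linarith [hle' g h, hK g h, hd0 g h]⟩

lemma IsMaximalMetric.coarselyLE [Countable M] {d del : MetricSpace (Aut L M)}
    (hd : IsMaximalMetric d) (hdel : IsCompatibleLeftInvariant del) : CoarselyLE del d := by
  obtain ⟨K, hK⟩ := hd.exists_seminorm_le (isContinuousSeminorm_metricSeminorm hdel)
  exact ⟨K, fun g h => by rw [dist_eq_metricSeminorm hdel]; exact hK g h⟩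

/-- Relative property (OB) bounds every continuous seminorm on a stabiliser. -/
lemma HasRelativeOB.exists_seminorm_le [Countable M] {a : List M}
    (ha : HasRelativeOB (tupleStabilizer L a)) {p : GroupSeminorm (Aut L M)}
    (hp : IsContinuousSeminorm p) : ∃ C : ℝ, ∀ v ∈ tupleStabilizer L a, p v ≤ C := by
  obtain ⟨d, hd, hle⟩ := exists_metric_ge hp
  obtain ⟨C, hC⟩ := ha d hd
  refine ⟨C, fun v hv => ?_⟩
  have := (hle 1 v).trans (hC 1 (map_autOne a) v hv)
  rwa [inv_one, one_mul] at this

end Metrics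

variable {L : Language} {M : Type*} [L.Structure M]

/-! ### Paths bound continuous seminorms -/

/-- If `p` is bounded on the stabiliser `V` of `a` and the orbital type of `(f a, g a)` belongs to a
finite set, then `f⁻¹ g` lies in one of finitely many double cosets of `V`, so that `p (f⁻¹ g)` is
bounded. The order of `f a` and `g a` is irrelevant since `p` is inversion-invariant. -/
lemma exists_step_bound (p : GroupSeminorm (Aut L M)) {a : List M} {B : ℝ}
    (hB : ∀ v ∈ tupleStabilizer L a, p v ≤ B) {S : Set (Set (List M))} (hS : S.Finite) :
    ∃ K : ℝ, 0 ≤ K ∧ ∀ f g : Aut L M, (orbitalType L (a.map f ++ a.map g) ∈ S ∨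
      orbitalType L (a.map g ++ a.map f) ∈ S) → p (f⁻¹ * g) ≤ K := by
  have hO : ∀ O : Set (List M), ∃ K : ℝ, ∀ f g : Aut L M,
      orbitalType L (a.map f ++ a.map g) = O → p (f⁻¹ * g) ≤ K := by
    intro O
    by_cases hne : ∃ f₀ g₀ : Aut L M, orbitalType L (a.map f₀ ++ a.map g₀) = O
    · obtain ⟨f₀, g₀, rfl⟩ := hne
      refine ⟨B + p (f₀⁻¹ * g₀) + B, fun f g hfg => ?_⟩
      obtain ⟨u, hu⟩ := exists_map_eq_of_orbitalType_eq hfg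
      rw [List.map_append] at hu
      obtain ⟨hu₁, hu₂⟩ := List.append_inj hu (by simp)
      rw [← map_autMul] at hu₁ hu₂
      have h₁ := hB _ (inv_mul_mem_tupleStabilizer hu₁)
      have h₂ := hB _ (inv_mul_mem_tupleStabilizer hu₂.symm)
      have heq : f⁻¹ * g = ((u * f)⁻¹ * f₀) * (f₀⁻¹ * g₀) * (g₀⁻¹ * (u * g)) := by group
      have h₃ := map_mul_le_add p (((u * f)⁻¹ * f₀) * (f₀⁻¹ * g₀)) (g₀⁻¹ * (u * g))
      have h₄ := map_mul_le_add p ((u * f)⁻¹ * f₀) (f₀⁻¹ * g₀)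
      rw [heq]
      linarith
    · exact ⟨0, fun f g h => absurd ⟨f, g, h⟩ hne⟩
  choose K hK using hO
  obtain ⟨C, hC⟩ := (hS.image K).bddAbove
  refine ⟨max C 0, le_max_right _ _, fun f g h => le_max_of_le_left ?_⟩
  rcases h with h | h
  · exact (hK _ f g rfl).trans (hC ⟨_, h, rfl⟩)
  · rw [← map_inv_eq_map p, mul_inv_rev, inv_inv]
    exact (hK _ g f rfl).trans (hC ⟨_, h, rfl⟩)

/-- The triangle inequality along a path of `n` steps. The last term `B` is needed since `f` and `g`
are determined by the end points of the path only up to the stabiliser of `a`. -/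
lemma seminorm_le_of_path (p : GroupSeminorm (Aut L M)) {a : List M} {B K : ℝ}
    (hB : ∀ v ∈ tupleStabilizer L a, p v ≤ B) {S : Set (Set (List M))}
    (hK : ∀ f g : Aut L M, (orbitalType L (a.map f ++ a.map g) ∈ S ∨
      orbitalType L (a.map g ++ a.map f) ∈ S) → p (f⁻¹ * g) ≤ K)
    (d : ℕ → List M) (n : ℕ) (hd : ∀ i ≤ n, d i ∈ orbitalType L a)
    (hS : ∀ i < n, orbitalType L (d i ++ d (i + 1)) ∈ S ∨ orbitalType L (d (i + 1) ++ d i) ∈ S)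
    {f g : Aut L M} (hf : a.map f = d 0) (hg : a.map g = d n) :
    p (f⁻¹ * g) ≤ n * K + B := by
  induction n generalizing g with
  | zero =>
    have := hB _ (inv_mul_mem_tupleStabilizer (hf.trans hg.symm))
    simpa using this
  | succ n ih =>
    obtain ⟨k, hk⟩ := hd n n.le_succ
    have h₁ := ih (fun i hi => hd i (hi.trans n.le_succ))
      (fun i hi => hS i (hi.trans n.lt_succ_self)) hk
    have h₂ := hK k g (by rw [hk, hg]; exact hS n n.lt_succ_self)
    have h₃ := map_mul_le_add p (f⁻¹ * k) (k⁻¹ * g)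
    rw [mul_assoc, mul_inv_cancel_left] at h₃
    push_cast
    linarith

/-- The unit ball of a compatible left-invariant metric at the identity contains the stabiliser of
some `b`, hence that of `(a, b)`. An element `g` of the stabiliser of `a` maps `(a, b)` to a point
`(a, c)`, and the paths of fixed length from `(a, b)` to these points bound its distance from the
identity. -/
lemma StabilizerCondition.hasRelativeOB {a : List M} (ha : StabilizerCondition L a) :
    HasRelativeOB (tupleStabilizer L a) := by
  intro d hd
  let p := metricSeminorm d hd
  obtain ⟨b, hb⟩ := isContinuousSeminorm_metricSeminorm hd 1 one_pos
  obtain ⟨S, hS, n, -, hpath⟩ := ha b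
  have hB : ∀ v ∈ tupleStabilizer L (a ++ b), p v ≤ 1 := fun v hv =>
    (hb v (mem_tupleStabilizer_append.1 hv).2).le
  obtain ⟨K, -, hK⟩ := exists_step_bound p hB hS.1
  have key : ∀ g ∈ tupleStabilizer L a, p g ≤ n * K + 1 := by
    intro g hg
    have hgab : (a ++ b).map g = a ++ b.map g := by
      rw [List.map_append]; exact congrArg (· ++ _) hg
    obtain ⟨e, he, he0, hen, heS⟩ := hpath (b.map g) (hgab ▸ map_mem_orbitalType _ g)
    have := seminorm_le_of_path p hB hK e n he (fun i hi => Or.inl (heS i hi))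
      (f := 1) (g := g) (by rw [map_autOne, he0]) (by rw [hgab, hen])
    rwa [inv_one, one_mul] at this
  refine ⟨(n * K + 1) + (n * K + 1), fun x hx y hy => ?_⟩
  have h := d.dist_triangle x 1 y
  rw [d.dist_comm x 1] at h
  exact h.trans (add_le_add (key x hx) (key y hy))

/-! ### Weights by orbital types and paths from words -/

section Weights

variable [Countable M]

variable (L M) in
lemma exists_injOn_orbitalTypes :
    ∃ E : Set (List M) → ℕ, Set.InjOn E (Set.range (orbitalType L (M := M))) :=
  Set.countable_iff_exists_injOn.1 (Set.countable_range _)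

variable (L) in
/-- A number attached to each set of tuples, injectively on the countable set of orbital types. -/
noncomputable def typeIndex : Set (List M) → ℕ := (exists_injOn_orbitalTypes L M).choose

variable (L M) in
/-- The finite family of the orbital types of index at most `n`. -/
def typesUpTo (n : ℕ) : Set (Set (List M)) :=
  {O | O ∈ Set.range (orbitalType L (M := M)) ∧ typeIndex L O ≤ n}

lemma isFiniteOrbitalFamily_typesUpTo (n : ℕ) : IsFiniteOrbitalFamily L (typesUpTo L M n) := by
  constructor
  · refine Set.Finite.of_finite_image ((Set.finite_Iic n).subset ?_)
      ((exists_injOn_orbitalTypes L M).choose_spec.mono fun O hO => hO.1)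
    rintro _ ⟨O, hO, rfl⟩
    exact hO.2
  · rintro O ⟨⟨a, rfl⟩, -⟩
    exact ⟨a, rfl⟩

/-- The larger of the indices of `𝒪(a, h a)` and `𝒪(a, h⁻¹ a)`. -/
noncomputable def stepIndex (a : List M) (h : Aut L M) : ℕ :=
  max (typeIndex L (orbitalType L (a ++ a.map h))) (typeIndex L (orbitalType L (a ++ a.map ⇑h⁻¹)))

lemma stepIndex_inv (a : List M) (h : Aut L M) : stepIndex a h⁻¹ = stepIndex a h := by
  rw [stepIndex, stepIndex, inv_inv, max_comm]

lemma mem_typesUpTo {a : List M} {h : Aut L M} {n : ℕ} (hn : stepIndex a h ≤ n) :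
    orbitalType L (a ++ a.map h) ∈ typesUpTo L M n :=
  ⟨⟨_, rfl⟩, (le_max_left _ _).trans hn⟩

open Classical in
/-- The weight which vanishes on the stabiliser of `a` and is `φ k + 1` on the other elements of
step index `k`. -/
noncomputable def stepWeight (φ : ℕ → ℕ) (a : List M) (h : Aut L M) : ℕ :=
  if a.map h = a then 0 else φ (stepIndex a h) + 1

lemma stepWeight_inv (φ : ℕ → ℕ) (a : List M) (h : Aut L M) :
    stepWeight φ a h⁻¹ = stepWeight φ a h := by
  have : a.map ⇑h⁻¹ = a ↔ a.map h = a := by rw [map_autInv_eq_iff, eq_comm]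
  unfold stepWeight
  rw [stepIndex_inv]
  by_cases h0 : a.map h = a
  · rw [if_pos h0, if_pos (this.2 h0)]
  · rw [if_neg h0, if_neg (mt this.1 h0)]

lemma stepWeight_eq_zero_iff {φ : ℕ → ℕ} {a : List M} {h : Aut L M} :
    stepWeight φ a h = 0 ↔ a.map h = a := by
  unfold stepWeight
  split_ifs with hh <;> simp [hh]

lemma lt_stepWeight {φ : ℕ → ℕ} {a : List M} {h : Aut L M} (hh : a.map h ≠ a) :
    φ (stepIndex a h) < stepWeight φ a h := by
  rw [stepWeight, if_neg hh]
  exact Nat.lt_succ_self _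

/-- The word seminorm for the weight `stepWeight φ a`. -/
noncomputable abbrev stepSeminorm (φ : ℕ → ℕ) (a : List M) : GroupSeminorm (Aut L M) :=
  wordSeminorm (stepWeight φ a) (stepWeight_inv φ a)

lemma isContinuousSeminorm_stepSeminorm (φ : ℕ → ℕ) (a : List M) :
    IsContinuousSeminorm (stepSeminorm φ a : GroupSeminorm (Aut L M)) := by
  refine .of_eq_zero a fun v hv => ?_
  have h := wordLength_le_weight (stepWeight φ a) v
  rw [stepWeight_eq_zero_iff.2 hv, Nat.le_zero] at h
  rw [wordSeminorm_apply, h, Nat.cast_zero]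

end Weights

lemma IsOrbitalPath.const {V : Set (List M)} {S : Set (Set (List M))} {x : List M} (hx : x ∈ V)
    (hS : orbitalType L (x ++ x) ∈ S) (n : ℕ) : IsOrbitalPath L V S x x n fun _ => x :=
  ⟨fun _ _ => hx, rfl, rfl, fun _ _ => hS⟩

lemma IsOrbitalPath.cons {V : Set (List M)} {S : Set (Set (List M))} {x y z : List M} {n : ℕ}
    {d : ℕ → List M} (hd : IsOrbitalPath L V S y z n d) (hx : x ∈ V)
    (hS : orbitalType L (x ++ y) ∈ S) :
    IsOrbitalPath L V S x z (n + 1) fun i => Nat.casesOn i x d := by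
  obtain ⟨hV, h0, hn, hs⟩ := hd
  refine ⟨fun i hi => ?_, rfl, hn, fun i hi => ?_⟩
  · cases i with
    | zero => exact hx
    | succ i => exact hV i (Nat.le_of_succ_le_succ hi)
  · cases i with
    | zero => change orbitalType L (x ++ d 0) ∈ S; rwa [h0]
    | succ i => exact hs i (Nat.lt_of_succ_lt_succ hi)

/-- The prefixes of a word, applied to `a`, form a path. Letters of weight zero do not move the
current point and are skipped; constant steps pad the path to the given length. -/
lemma exists_path_of_word {a : List M} {S : Set (Set (List M))}
    (haa : orbitalType L (a ++ a) ∈ S) {w : Aut L M → ℕ} (hw : ∀ h, w h = 0 → a.map h = a)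
    (l : List (Aut L M)) (hl : ∀ h ∈ l, orbitalType L (a ++ a.map h) ∈ S)
    (f : Aut L M) (n : ℕ) (hn : (l.map w).sum ≤ n) :
    ∃ d, IsOrbitalPath L (orbitalType L a) S (a.map f) (a.map (f * l.prod)) n d := by
  induction l generalizing f n with
  | nil =>
    rw [List.prod_nil, mul_one]
    exact ⟨_, .const (map_mem_orbitalType a f) (by rwa [orbitalType_map_append]) n⟩
  | cons h l ih =>
    have hl' := fun k hk => hl k (List.mem_cons_of_mem h hk)
    rw [List.map_cons, List.sum_cons] at hn
    rw [List.prod_cons, ← mul_assoc]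
    by_cases h0 : w h = 0
    · have := ih hl' (f * h) n (by lia)
      rwa [map_autMul f h, hw h h0] at this
    · obtain ⟨m, rfl⟩ : ∃ m, n = m + 1 := ⟨n - 1, by lia⟩
      obtain ⟨d, hd⟩ := ih hl' (f * h) m (by lia)
      refine ⟨_, hd.cons (map_mem_orbitalType a f) ?_⟩
      rw [map_autMul, orbitalType_map_append]
      exact hl h List.mem_cons_self

lemma IsFiniteOrbitalFamily.insert {S : Set (Set (List M))} (hS : IsFiniteOrbitalFamily L S)
    (b : List M) : IsFiniteOrbitalFamily L (insert (orbitalType L b) S) :=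
  ⟨hS.1.insert _, by
    rintro O (rfl | hO)
    exacts [⟨b, rfl⟩, hS.2 O hO]⟩

/-- Boundedness of the step seminorm of `(a, b)` on the stabiliser of `a` bounds both the number of
nontrivial letters and the indices of their types in words for the elements of this stabiliser. -/
lemma HasRelativeOB.stabilizerCondition [Countable M] {a : List M}
    (ha : HasRelativeOB (tupleStabilizer L a)) : StabilizerCondition L a := by
  intro b
  obtain ⟨C, hC⟩ := ha.exists_seminorm_le (isContinuousSeminorm_stepSeminorm id (a ++ b))
  obtain ⟨n, hn⟩ := exists_nat_ge C
  let S := insert (orbitalType L ((a ++ b) ++ (a ++ b))) (typesUpTo L M n)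
  refine ⟨S, (isFiniteOrbitalFamily_typesUpTo n).insert _, n + 1, Nat.le_add_left 1 n, ?_⟩
  rintro c ⟨g, hg⟩
  have hga : g ∈ tupleStabilizer L a := by
    rw [List.map_append] at hg
    exact (List.append_inj hg (by simp)).1
  obtain ⟨l, rfl, hl⟩ := exists_word (stepWeight id (a ++ b)) g
  have hle : wordLength (stepWeight id (a ++ b)) l.prod ≤ n := by
    have h := (hC _ hga).trans hn
    rw [wordSeminorm_apply] at h
    exact_mod_cast h
  have hlS : ∀ h ∈ l, orbitalType L ((a ++ b) ++ (a ++ b).map h) ∈ S := by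
    intro h hh
    by_cases h0 : (a ++ b).map h = a ++ b
    · rw [h0]; exact Set.mem_insert _ _
    · have h₁ := lt_stepWeight (φ := id) h0
      have h₂ := List.single_le_sum (fun _ _ => Nat.zero_le _) _
        (List.mem_map_of_mem (f := stepWeight id (a ++ b)) hh)
      exact Set.mem_insert_of_mem _ (mem_typesUpTo (by dsimp only [id] at h₁; lia))
  have := exists_path_of_word (Set.mem_insert _ _) (w := stepWeight id (a ++ b))
    (fun h => stepWeight_eq_zero_iff.1) l hlS 1 (n + 1) (by lia)
  rwa [map_autOne, one_mul, hg] at this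

lemma stabilizerCondition_iff_hasRelativeOB [Countable M] {a : List M} :
    StabilizerCondition L a ↔ HasRelativeOB (tupleStabilizer L a) :=
  ⟨fun h => h.hasRelativeOB, fun h => h.stabilizerCondition⟩

/-! ### Connecting families and the orbital graph -/

lemma IsConnectingFamily.connected {a : List M} {R : Set (Set (List M))}
    (hR : IsConnectingFamily L a R) : (orbitalGraph L a R).Connected := by
  rw [SimpleGraph.connected_iff_exists_forall_reachable]
  refine ⟨⟨a, self_mem_orbitalType a⟩, fun ⟨b, hb⟩ => ?_⟩
  obtain ⟨m, d, hd, h0, hm, hs⟩ := hR.2 b hb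
  have key : ∀ i (hi : i ≤ m), (orbitalGraph L a R).Reachable ⟨a, self_mem_orbitalType a⟩
      ⟨d i, hd i hi⟩ := by
    intro i
    induction i with
    | zero => intro hi; simp only [h0]; exact .rfl
    | succ i ih =>
      intro hi
      refine (ih (Nat.le_of_succ_le hi)).trans ?_
      by_cases h : d i = d (i + 1)
      · simp only [h]; exact .rfl
      · exact SimpleGraph.Adj.reachable ⟨fun he => h (congrArg Subtype.val he), Or.inl (hs i hi)⟩
  simpa only [hm] using key m le_rfl

/-- Adjacency allows both orientations of a type in `R`, so the types in `R` with their two halves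
exchanged are added to obtain a connecting family. -/
lemma exists_isConnectingFamily_of_connected {a : List M} {R : Set (Set (List M))}
    (hR : IsFiniteOrbitalFamily L R) (hc : (orbitalGraph L a R).Connected) :
    ∃ R', IsConnectingFamily L a R' := by
  let R' := R ∪ ((fun O => (fun l => l.rotate a.length) '' O) '' R ∩ Set.range (orbitalType L))
  refine ⟨R', ⟨hR.1.union ((hR.1.image _).inter_of_left _), ?_⟩, fun b hb => ?_⟩
  · rintro O (hO | ⟨-, c, rfl⟩)
    exacts [hR.2 O hO, ⟨c, rfl⟩]
  · obtain ⟨p⟩ := hc.preconnected ⟨a, self_mem_orbitalType a⟩ ⟨b, hb⟩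
    refine ⟨p.length, fun i => (p.getVert i).1, fun i _ => (p.getVert i).2, by simp, by simp,
      fun i hi => ?_⟩
    rcases (p.adj_getVert_succ hi).2 with h | h
    · exact Or.inl h
    · refine Or.inr ⟨⟨_, h, ?_⟩, _, rfl⟩
      rw [orbitalType_swap (p.getVert (i + 1)).1 (p.getVert i).1,
        length_of_mem_orbitalType (p.getVert (i + 1)).2]

/-- The action of an automorphism on the orbital graph. -/
def orbitalGraphHom (a : List M) (R : Set (Set (List M))) (g : Aut L M) :
    orbitalGraph L a R →g orbitalGraph L a R where
  toFun b := ⟨b.1.map g, by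
    obtain ⟨f, hf⟩ := b.2
    exact ⟨g * f, by rw [map_autMul, hf]⟩⟩
  map_rel' := by
    rintro b c ⟨hne, h⟩
    refine ⟨fun he => hne (Subtype.ext ?_), ?_⟩
    · exact List.map_injective_iff.2 g.injective (congrArg Subtype.val he)
    · rwa [orbitalType_map_append, orbitalType_map_append]

lemma orbitalGraphHom_orbitMap (a : List M) (R : Set (Set (List M))) (f g : Aut L M) :
    orbitalGraphHom a R f (orbitMap L a g) = orbitMap L a (f * g) :=
  Subtype.ext (map_autMul f g a).symm

lemma orbitalDist_self (a : List M) (R : Set (Set (List M))) (b : orbitalType L a) :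
    orbitalDist L a R b b = 0 := by
  rw [orbitalDist, SimpleGraph.dist_self, Nat.cast_zero]

lemma dist_mul_left_le {a : List M} {R : Set (Set (List M))}
    (hc : (orbitalGraph L a R).Connected) (f g h : Aut L M) :
    (orbitalGraph L a R).dist (orbitMap L a (f * g)) (orbitMap L a (f * h)) ≤
      (orbitalGraph L a R).dist (orbitMap L a g) (orbitMap L a h) := by
  obtain ⟨p, hp⟩ := hc.exists_walk_length_eq_dist (orbitMap L a g) (orbitMap L a h)
  rw [← hp, ← orbitalGraphHom_orbitMap a R f g, ← orbitalGraphHom_orbitMap a R f h,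
    ← SimpleGraph.Walk.length_map (orbitalGraphHom a R f) p]
  exact SimpleGraph.dist_le _

lemma orbitalDist_mul_left {a : List M} {R : Set (Set (List M))}
    (hc : (orbitalGraph L a R).Connected) (f g h : Aut L M) :
    orbitalDist L a R (orbitMap L a (f * g)) (orbitMap L a (f * h)) =
      orbitalDist L a R (orbitMap L a g) (orbitMap L a h) := by
  refine congrArg Nat.cast (le_antisymm (dist_mul_left_le hc f g h) ?_)
  have := dist_mul_left_le hc f⁻¹ (f * g) (f * h)
  rwa [inv_mul_cancel_left, inv_mul_cancel_left] at this

/-- The seminorm `g ↦ ρ(a, g a)` of the shortest path distance. -/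
noncomputable def orbitalSeminorm {a : List M} {R : Set (Set (List M))}
    (hc : (orbitalGraph L a R).Connected) : GroupSeminorm (Aut L M) where
  toFun g := orbitalDist L a R (orbitMap L a 1) (orbitMap L a g)
  map_one' := orbitalDist_self a R _
  mul_le' g h := by
    have h₁ := orbitalDist_mul_left hc g 1 h
    rw [mul_one] at h₁
    rw [← h₁]
    unfold orbitalDist
    exact_mod_cast hc.dist_triangle
  inv' g := by
    have h := orbitalDist_mul_left hc g 1 g⁻¹
    rw [mul_one, mul_inv_cancel] at h
    rw [← h]
    exact congrArg Nat.cast SimpleGraph.dist_comm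

lemma orbitalSeminorm_inv_mul {a : List M} {R : Set (Set (List M))}
    (hc : (orbitalGraph L a R).Connected) (g h : Aut L M) :
    orbitalSeminorm hc (g⁻¹ * h) = orbitalDist L a R (orbitMap L a g) (orbitMap L a h) := by
  have := orbitalDist_mul_left hc g⁻¹ g h
  rwa [inv_mul_cancel] at this

lemma isContinuousSeminorm_orbitalSeminorm {a : List M} {R : Set (Set (List M))}
    (hc : (orbitalGraph L a R).Connected) : IsContinuousSeminorm (orbitalSeminorm hc) := by
  refine .of_eq_zero a fun v hv => ?_
  have : orbitMap L a v = orbitMap L a 1 := Subtype.ext (hv.trans (map_autOne a).symm)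
  change orbitalDist L a R (orbitMap L a 1) (orbitMap L a v) = 0
  rw [this, orbitalDist_self]

/-- Every compatible left-invariant metric is coarsely dominated by the shortest path distance: it
is bounded on the stabiliser of `a` and on each step of a shortest path. -/
lemma exists_dist_le_orbitalDist {a : List M} {R : Set (Set (List M))}
    (ha : StabilizerCondition L a) (hR : R.Finite) (hc : (orbitalGraph L a R).Connected)
    {d : MetricSpace (Aut L M)} (hd : IsCompatibleLeftInvariant d) :
    ∃ K : ℝ, 0 ≤ K ∧ ∀ g h,
      d.dist g h ≤ K * orbitalDist L a R (orbitMap L a g) (orbitMap L a h) + K := by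
  obtain ⟨B, hB⟩ := ha.hasRelativeOB d hd
  have hB' : ∀ v ∈ tupleStabilizer L a, metricSeminorm d hd v ≤ B :=
    fun v hv => hB 1 (map_autOne a) v hv
  obtain ⟨K, hK0, hK⟩ := exists_step_bound (metricSeminorm d hd) hB' hR
  refine ⟨max K B, le_max_of_le_left hK0, fun g h => ?_⟩
  obtain ⟨p, hp⟩ := hc.exists_walk_length_eq_dist (orbitMap L a g) (orbitMap L a h)
  have := seminorm_le_of_path (metricSeminorm d hd) hB' hK (fun i => (p.getVert i).1) p.length
    (fun i _ => (p.getVert i).2) (fun i hi => (p.adj_getVert_succ hi).2)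
    (f := g) (g := h) (by rw [p.getVert_zero]; rfl) (by rw [p.getVert_length]; rfl)
  rw [hp, ← dist_eq_metricSeminorm hd, mul_comm] at this
  exact this.trans (add_le_add
    (mul_le_mul_of_nonneg_right (le_max_left _ _) (Nat.cast_nonneg _)) (le_max_right _ _))

lemma exists_isMaximalMetric [Countable M] {a : List M} {R : Set (Set (List M))}
    (ha : StabilizerCondition L a) (hR : IsConnectingFamily L a R) :
    ∃ d : MetricSpace (Aut L M), IsMaximalMetric d := by
  obtain ⟨d, hd, hle⟩ := exists_metric_ge (isContinuousSeminorm_orbitalSeminorm hR.connected)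
  refine ⟨d, hd, fun del hdel _ => ?_⟩
  obtain ⟨K, hK0, hK⟩ := exists_dist_le_orbitalDist ha hR.1.1 hR.connected hdel
  refine ⟨K, fun g h => (hK g h).trans ?_⟩
  rw [← orbitalSeminorm_inv_mul hR.connected]
  gcongr
  exact hle g h

lemma isQuasiIsometry_orbitMap [Countable M] {a : List M} {R : Set (Set (List M))}
    (ha : StabilizerCondition L a) (hR : IsConnectingFamily L a R)
    {d : MetricSpace (Aut L M)} (hd : IsMaximalMetric d) :
    IsQuasiIsometry d.dist (orbitalDist L a R) (orbitMap L a) := by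
  have hc := hR.connected
  obtain ⟨K₁, hK₁, h₁⟩ := exists_dist_le_orbitalDist ha hR.1.1 hc hd.1
  obtain ⟨K₂, h₂⟩ := hd.exists_seminorm_le (isContinuousSeminorm_orbitalSeminorm hc)
  have hd0 : ∀ g h, 0 ≤ d.dist g h := @dist_nonneg _ d.toPseudoMetricSpace
  let K := max 1 (max K₁ K₂)
  have hK1 : (1 : ℝ) ≤ K := le_max_left _ _
  have hKK₁ : K₁ ≤ K := (le_max_left _ _).trans (le_max_right _ _)
  have hKK₂ : K₂ ≤ K := (le_max_right _ _).trans (le_max_right _ _)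
  refine ⟨K, K, hK1, by linarith, fun g h => ⟨?_, ?_⟩, fun ⟨y, g, hg⟩ => ⟨g, ?_⟩⟩
  · have hρ : 0 ≤ orbitalDist L a R (orbitMap L a g) (orbitMap L a h) := Nat.cast_nonneg _
    have h₃ : d.dist g h ≤ K * (orbitalDist L a R (orbitMap L a g) (orbitMap L a h) + K) := by
      nlinarith [h₁ g h, mul_le_mul_of_nonneg_right hKK₁ hρ]
    rw [sub_le_iff_le_add, one_div, inv_mul_le_iff₀ (by linarith)]
    exact h₃
  · rw [← orbitalSeminorm_inv_mul hc]
    exact (h₂ g h).trans (add_le_add (mul_le_mul_of_nonneg_right hKK₂ (hd0 g h)) hKK₂)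
  · have : orbitMap L a g = ⟨y, g, hg⟩ := Subtype.ext hg
    rw [this, orbitalDist_self]
    linarith

/-! ### Tuples from a maximal metric -/

/-- The stabiliser of a tuple inside the unit ball of a maximal metric is bounded in that metric,
hence in all compatible left-invariant metrics. -/
lemma IsMaximalMetric.exists_stabilizerCondition [Countable M] {d : MetricSpace (Aut L M)}
    (hd : IsMaximalMetric d) : ∃ a : List M, StabilizerCondition L a := by
  obtain ⟨a, ha⟩ := isContinuousSeminorm_metricSeminorm hd.1 1 one_pos
  refine ⟨a, HasRelativeOB.stabilizerCondition fun del hdel => ?_⟩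
  obtain ⟨K, hK⟩ := hd.coarselyLE hdel
  have hK0 : 0 ≤ K := by
    have := hK 1 1
    rwa [del.dist_self, d.dist_self, mul_zero, zero_add] at this
  refine ⟨K * 2 + K, fun x hx y hy => (hK x y).trans ?_⟩
  gcongr
  have h := d.dist_triangle x 1 y
  rw [d.dist_comm x 1] at h
  have hx' : d.dist 1 x < 1 := ha x hx
  have hy' : d.dist 1 y < 1 := ha y hy
  linarith

/-- If no finite family connects `𝒪(a)`, then for each `n` the types of index at most `n` miss some
point `g n · a`. Words for `g n` contain a letter of index greater than `n`, and weights growing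
fast enough make the word length of `g n` outrun any given maximal metric. -/
lemma IsMaximalMetric.exists_isConnectingFamily [Countable M] {d : MetricSpace (Aut L M)}
    (hd : IsMaximalMetric d) (a : List M) : ∃ R, IsConnectingFamily L a R := by
  by_contra hno
  let S : ℕ → Set (Set (List M)) := fun n => insert (orbitalType L (a ++ a)) (typesUpTo L M n)
  have hmiss : ∀ n, ∃ g : Aut L M,
      ¬ ∃ (m : ℕ) (e : ℕ → List M), IsOrbitalPath L (orbitalType L a) (S n) a (a.map g) m e := by
    intro n
    by_contra! h
    refine hno ⟨S n, (isFiniteOrbitalFamily_typesUpTo n).insert _, ?_⟩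
    rintro _ ⟨g, rfl⟩
    exact h g
  choose g hg using hmiss
  -- `φ` is monotone and `φ n` exceeds `n * d 1 (g n) + n`
  let φ : ℕ → ℕ := fun k => ∑ i ∈ Finset.range (k + 1), ⌈(i : ℝ) * d.dist 1 (g i) + i⌉₊
  have hφ : Monotone φ := fun i j hij =>
    Finset.sum_le_sum_of_subset (Finset.range_mono (Nat.succ_le_succ hij))
  have hφ' : ∀ n : ℕ, (n : ℝ) * d.dist 1 (g n) + n ≤ φ n := fun n =>
    (Nat.le_ceil _).trans (Nat.cast_le.2 (Finset.single_le_sum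
      (f := fun i : ℕ => ⌈(i : ℝ) * d.dist 1 (g i) + i⌉₊) (fun _ _ => Nat.zero_le _)
      (Finset.self_mem_range_succ n)))
  obtain ⟨K, hK⟩ := hd.exists_seminorm_le (isContinuousSeminorm_stepSeminorm φ a)
  obtain ⟨n, hn⟩ := exists_nat_ge K
  have hd0 : 0 ≤ d.dist 1 (g n) := @dist_nonneg _ d.toPseudoMetricSpace _ _
  have hlen : wordLength (stepWeight φ a) (g n) ≤ φ n := by
    have h := hK 1 (g n)
    rw [inv_one, one_mul, wordSeminorm_apply] at h
    have := mul_le_mul_of_nonneg_right hn hd0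
    exact_mod_cast h.trans ((add_le_add this hn).trans (hφ' n))
  obtain ⟨l, hl, hw⟩ := exists_word (stepWeight φ a) (g n)
  have hlS : ∀ h ∈ l, orbitalType L (a ++ a.map h) ∈ S n := by
    intro h hh
    by_cases h0 : a.map h = a
    · rw [h0]; exact Set.mem_insert _ _
    · have h₁ := lt_stepWeight (φ := φ) h0
      have h₂ := List.single_le_sum (fun _ _ => Nat.zero_le _) _
        (List.mem_map_of_mem (f := stepWeight φ a) hh)
      exact Set.mem_insert_of_mem _ (mem_typesUpTo (hφ.reflect_lt (by lia)).le)
  have := exists_path_of_word (Set.mem_insert _ _) (w := stepWeight φ a)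
    (fun h => stepWeight_eq_zero_iff.1) l hlS 1 _ le_rfl
  rw [map_autOne, one_mul, hl] at this
  exact hg n ⟨_, this⟩

end OrbitalGeometry

theorem mainTheorem1 (L : Language) (M : Type*) [L.Structure M] [Countable M] :
    ((∃ d : MetricSpace (Aut L M), IsMaximalMetric d) ↔
      ∃ a : List M, StabilizerCondition L a ∧
        ∃ R : Set (Set (List M)), IsConnectingFamily L a R) ∧
    (∀ a : List M,
      (StabilizerCondition L a ↔ HasRelativeOB (tupleStabilizer L a)) ∧
      ((∃ R : Set (Set (List M)), IsConnectingFamily L a R) ↔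
        ∃ R : Set (Set (List M)), IsFiniteOrbitalFamily L R ∧ (orbitalGraph L a R).Connected)) ∧
    (∀ (a : List M) (R : Set (Set (List M))),
      StabilizerCondition L a → IsConnectingFamily L a R →
        (orbitalGraph L a R).Connected ∧
        ∀ d : MetricSpace (Aut L M), IsMaximalMetric d →
          IsQuasiIsometry d.dist (orbitalDist L a R) (orbitMap L a)) := by
  refine ⟨⟨?_, ?_⟩, fun a => ⟨stabilizerCondition_iff_hasRelativeOB, ?_, ?_⟩,
    fun a R ha hR => ⟨hR.connected, fun d hd => isQuasiIsometry_orbitMap ha hR hd⟩⟩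
  · rintro ⟨d, hd⟩
    obtain ⟨a, ha⟩ := hd.exists_stabilizerCondition
    exact ⟨a, ha, hd.exists_isConnectingFamily a⟩
  · rintro ⟨a, ha, R, hR⟩
    exact exists_isMaximalMetric ha hR
  · rintro ⟨R, hR⟩
    exact ⟨R, hR.1, hR.connected⟩
  · rintro ⟨R, hR, hc⟩
    exact exists_isConnectingFamily_of_connected hR hc
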